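/- A deterministic one-tape Turing machine (DTM) is a tuple $M=(Q,\Sigma,\Gamma,\delta,q_0,F)$ with a finite set of states $Q$, a finite working alphabet $\Gamma$ containing a blank symbol $b$, an input alphabet $\Sigma\subseteq\Gamma\setminus\{b\}$, an initial state $q_0\in Q$, a set $F\subseteq Q$ of final states, and a partial transition function $\delta\colon Q\times\Gamma\rightharpoonup Q\times(\Gamma\setminus\{b\})\times\{-1,+1\}$. The machine works on a bi-infinite tape. On input $w\in\Sigma^*$ it starts in $q_0$ with $w$ on the tape, all other cells blank, and the head on the leftmost symbol of $w$ (on a blank cell if $w$ is empty); it halts when no transition is applicable. The DTM $M$ is *weight-reducing* if there is a partial order $<$ on $\Gamma$ such that $\delta(p,\sigma)=(q,\tau,d)$ implies $\tau<\sigma$. **Theorem.** It is decidable whether a weight-reducing DTM halts on each input string. That is, writing $\langle M\rangle$ for the finite description of a DTM $M$ with $Q=\{0,\dots,n-1\}$ and $\Gamma=\{0,\dots,m-1\}$ (the numbers $n$, $m$, the blank, the input alphabet, the transition table, the initial state and the final states), the set $$\{\langle M\rangle \mid M \text{ is a weight-reducing DTM that halts on every input } w\in\Sigma^*\}$$ is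 decidable. -/

import Mathlib

/-- A deterministic one-tape Turing machine `(Q, Σ, Γ, δ, q₀, F)` with set of states `Q` and working
alphabet `Γ`. The input alphabet is a set of nonblank working symbols, the transition function is
partial (`none` means undefined), the blank is never written, and every move is one cell to the
left or one cell to the right. -/
structure DTM (Q Γ : Type*) where
  inputAlphabet : Set Γ
  blank : Γ
  blank_notMem : blank ∉ inputAlphabet
  δ : Q → Γ → Option (Q × Γ × Turing.Dir)
  not_write_blank : ∀ p σ q τ d, δ p σ = some (q, τ, d) → τ ≠ blank
  start : Q
  final : Set Q

namespace DTM

variable {Q Γ : Type*}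

/-- A configuration: the current state, the head position and the contents of the bi-infinite
tape. -/
@[ext]
structure Cfg (Q Γ : Type*) where
  state : Q
  head : ℤ
  tape : ℤ → Γ

/-- The displacement of the head caused by a move. -/
def shift : Turing.Dir → ℤ
  | Turing.Dir.left => -1
  | Turing.Dir.right => 1

/-- `M.Yields c c'`: the configuration `c'` is a successor of the configuration `c`. -/
def Yields (M : DTM Q Γ) (c c' : Cfg Q Γ) : Prop :=
  ∃ q τ d, M.δ c.state (c.tape c.head) = some (q, τ, d) ∧
    c' = ⟨q, c.head + shift d, Function.update c.tape c.head τ⟩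

/-- The initial tape on input `w`: the word `w` on the cells `0, …, |w| - 1`, blanks elsewhere. -/
def initTape (M : DTM Q Γ) (w : List Γ) (i : ℤ) : Γ :=
  if 0 ≤ i then w.getD i.toNat M.blank else M.blank

/-- The initial configuration on input `w`: the head scans the leftmost symbol of `w` (a blank cell
if `w` is empty). -/
def initCfg (M : DTM Q Γ) (w : List Γ) : Cfg Q Γ :=
  ⟨M.start, 0, M.initTape w⟩

/-- A halting configuration: one that has no successor. -/
def IsHalting (M : DTM Q Γ) (c : Cfg Q Γ) : Prop :=
  ∀ c', ¬ M.Yields c c'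

/-- The computation of `M` on `w` reaches a halting configuration. -/
def HaltsOn (M : DTM Q Γ) (w : List Γ) : Prop :=
  ∃ c, Relation.ReflTransGen M.Yields (M.initCfg w) c ∧ M.IsHalting c

/-- `M` halts on each string over its input alphabet. -/
def HaltsOnEveryInput (M : DTM Q Γ) : Prop :=
  ∀ w : List Γ, (∀ a ∈ w, a ∈ M.inputAlphabet) → M.HaltsOn w

/-- `M` is weight-reducing: for some (strict) partial order on the working alphabet, each rewriting
is decreasing. -/
def IsWeightReducing (M : DTM Q Γ) : Prop :=
  ∃ lt : Γ → Γ → Prop, IsStrictOrder Γ lt ∧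
    ∀ p σ q τ d, M.δ p σ = some (q, τ, d) → lt τ σ

/-- The type of finite descriptions of machines: number of states, number of working symbols,
index of the blank, indicator list of the input alphabet, transition table (one row per state, one
entry per symbol), index of the initial state, indicator list of the final states. -/
abbrev Code : Type :=
  ℕ × ℕ × ℕ × List Bool × List (List (Option (ℕ × ℕ × Bool))) × ℕ × List Bool

/-- The description of one transition `(q, τ, d)`; moves are coded by `false` (left) and `true`
(right). -/
def codeAction {n m : ℕ} (x : Fin n × Fin m × Turing.Dir) : ℕ × ℕ × Bool :=
  (x.1, x.2.1, decide (x.2.2 = Turing.Dir.right))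

open Classical in
/-- The description of a machine with states `0, …, n - 1` and working symbols `0, …, m - 1`. -/
noncomputable def code {n m : ℕ} (M : DTM (Fin n) (Fin m)) : Code :=
  (n, m, M.blank,
    List.ofFn fun a => decide (a ∈ M.inputAlphabet),
    List.ofFn fun q => List.ofFn fun a => (M.δ q a).map codeAction,
    M.start,
    List.ofFn fun q => decide (q ∈ M.final))

theorem codeAction_injective {n m : ℕ} : Function.Injective (@codeAction n m) := by
  rintro ⟨q, τ, d⟩ ⟨q', τ', d'⟩ h
  cases d <;> cases d' <;> simp_all [codeAction, Fin.ext_iff]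

/-- A machine is determined by its description. -/
theorem code_injective :
    Function.Injective fun M : (n : ℕ) × (m : ℕ) × DTM (Fin n) (Fin m) => M.2.2.code := by
  rintro ⟨n, m, M⟩ ⟨n', m', M'⟩ h
  simp only [code, Prod.mk.injEq] at h
  obtain ⟨rfl, rfl, h1, h2, h3, h4, h5⟩ := h
  obtain ⟨A, b, hb, δ, hδ, s, F⟩ := M
  obtain ⟨A', b', hb', δ', hδ', s', F'⟩ := M'
  simp only [List.ofFn_inj, funext_iff, decide_eq_decide, Fin.val_inj] at h1 h2 h3 h4 h5
  obtain rfl : A = A' := Set.ext h2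
  obtain rfl : F = F' := Set.ext h5
  obtain rfl : δ = δ' :=
    funext fun q => funext fun a => Option.map_injective codeAction_injective (h3 q a)
  subst h1 h4
  rfl

end DTM

/-! The number of symbols below a given one is a rank less than `m`, and each rewriting lowers the
rank of the scanned cell, so a cell is rewritten fewer than `m` times. Since a halting computation
uses finitely many cells (`DTM.haltsOn_iff`), it can be studied on a finite piece of tape, cut at
some boundary. The head enters the right part at its first cell, and a visit that ends by leaving to
the left has rewritten this cell (`Exits.rank_lt`); hence there are at most `m` visits. All that the
left part notices is, for each entry state, whether the visit halts or in which state it ends, and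
then the same for the remaining visits. These nested data form one of `N = numBehaviours n m`
behaviours, and right parts with equal behaviour are interchangeable (`haltsWithin.replace`).

Pumping now gives all bounds. Among the blank paddings of lengths `0, …, N` two behave alike, so
padding longer than `N` can be shortened, on the right and by reflection on the left. Likewise two
suffixes of a word longer than `N` behave alike, and excising the factor between them does not
change whether the machine halts; so the words of length at most `N` decide the matter. The sum of
the ranks drops at each step, which bounds the time. What remains are finitely many bounded
simulations and a finite search for a rank function, all primitive recursive in the code. -/

/-! ### Computations on finite pieces of tape -/

/-- Transition functions with moves coded by `false` (left) and `true` (right). -/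
abbrev TransFun (Q Γ : Type*) : Type _ := Q → Γ → Option (Q × Γ × Bool)

namespace TransFun

variable {Q Γ : Type*} (δ : TransFun Q Γ)

/-- Whether the computation on a finite piece of tape reaches a cell without applicable transition
in fewer than `t` steps. The head scans the first cell of `R`; the list `L` holds the cells to the
left of the head, the nearest one first. Leaving the piece of tape counts as not halting. -/
def haltsWithin : ℕ → List Γ → Q → List Γ → Bool
  | 0, _, _, _ => false
  | _ + 1, _, _, [] => false
  | t + 1, L, q, a :: R =>
    match δ q a with
    | none => true
    | some (q', τ, true) => haltsWithin t (τ :: L) q' R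
    | some (q', τ, false) =>
      match L with
      | [] => false
      | x :: L' => haltsWithin t L' q' (x :: τ :: R)

/-- The computation on a finite piece of tape halts without leaving it. -/
def Halts (L : List Γ) (q : Q) (R : List Γ) : Prop :=
  ∃ t, δ.haltsWithin t L q R = true

/-- The computation on a finite piece of tape leaves it at its left end, in state `q'` and with
final contents `R'`. -/
inductive Exits : List Γ → Q → List Γ → Q → List Γ → Prop
  | exit {q a R q' τ} : δ q a = some (q', τ, false) → Exits [] q (a :: R) q' (τ :: R)
  | right {L q a R q' τ p S} : δ q a = some (q', τ, true) → Exits (τ :: L) q' R p S →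
      Exits L q (a :: R) p S
  | left {x L q a R q' τ p S} : δ q a = some (q', τ, false) → Exits L q' (x :: τ :: R) p S →
      Exits (x :: L) q (a :: R) p S

variable {δ}

theorem Halts.of_none {L : List Γ} {q : Q} {a : Γ} {R : List Γ} (h : δ q a = none) :
    δ.Halts L q (a :: R) :=
  ⟨1, by simp [haltsWithin, h]⟩

theorem Halts.right {L : List Γ} {q q' : Q} {a τ : Γ} {R : List Γ}
    (h : δ q a = some (q', τ, true)) : δ.Halts (τ :: L) q' R → δ.Halts L q (a :: R) := by
  rintro ⟨t, ht⟩
  exact ⟨t + 1, by simpa [haltsWithin, h] using ht⟩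

theorem Halts.left {L : List Γ} {q q' : Q} {x a τ : Γ} {R : List Γ}
    (h : δ q a = some (q', τ, false)) :
    δ.Halts L q' (x :: τ :: R) → δ.Halts (x :: L) q (a :: R) := by
  rintro ⟨t, ht⟩
  exact ⟨t + 1, by simpa [haltsWithin, h] using ht⟩

/-- Case distinction on the first step of a halting computation. -/
theorem haltsWithin_succ_cases {t : ℕ} {L : List Γ} {q : Q} {R : List Γ}
    (h : δ.haltsWithin (t + 1) L q R = true) :
    ∃ a R', R = a :: R' ∧ (δ q a = none ∨
      (∃ q' τ, δ q a = some (q', τ, true) ∧ δ.haltsWithin t (τ :: L) q' R' = true) ∨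
      ∃ q' τ x L', L = x :: L' ∧ δ q a = some (q', τ, false) ∧
        δ.haltsWithin t L' q' (x :: τ :: R') = true) := by
  cases R with
  | nil => simp [haltsWithin] at h
  | cons a R' =>
    refine ⟨a, R', rfl, ?_⟩
    rcases hd : δ q a with _ | ⟨q', τ, _ | _⟩
    · exact Or.inl rfl
    · cases L with
      | nil => simp [haltsWithin, hd] at h
      | cons x L' =>
        exact Or.inr (Or.inr ⟨q', τ, x, L', rfl, rfl, by simpa [haltsWithin, hd] using h⟩)
    · exact Or.inr (Or.inl ⟨q', τ, rfl, by simpa [haltsWithin, hd] using h⟩)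

/-- Induction principle for halting computations. -/
theorem Halts.rec_on {P : List Γ → Q → List Γ → Prop}
    (none : ∀ L q a R, δ q a = none → P L q (a :: R))
    (right : ∀ L q a R q' τ, δ q a = some (q', τ, true) → δ.Halts (τ :: L) q' R →
      P (τ :: L) q' R → P L q (a :: R))
    (left : ∀ x L q a R q' τ, δ q a = some (q', τ, false) → δ.Halts L q' (x :: τ :: R) →
      P L q' (x :: τ :: R) → P (x :: L) q (a :: R))
    {L : List Γ} {q : Q} {R : List Γ} (h : δ.Halts L q R) : P L q R := by
  obtain ⟨t, ht⟩ := h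
  induction t generalizing L q R with
  | zero => simp [haltsWithin] at ht
  | succ t ih =>
    obtain ⟨a, R', rfl, hd | ⟨q', τ, hd, h'⟩ | ⟨q', τ, x, L', rfl, hd, h'⟩⟩ :=
      haltsWithin_succ_cases ht
    · exact none _ _ _ _ hd
    · exact right _ _ _ _ _ _ hd ⟨t, h'⟩ (ih h')
    · exact left _ _ _ _ _ _ _ hd ⟨t, h'⟩ (ih h')

/-- A computation that halts without leaving its piece of tape never notices additional cells beyond
either end. -/
theorem Halts.append {L : List Γ} {q : Q} {R : List Γ} (h : δ.Halts L q R) (L₂ R₂ : List Γ) :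
    δ.Halts (L ++ L₂) q (R ++ R₂) := by
  refine h.rec_on (P := fun L q R => δ.Halts (L ++ L₂) q (R ++ R₂)) ?_ ?_ ?_
  · intro L q a R h
    exact .of_none h
  · intro L q a R q' τ h _ ih
    exact .right h ih
  · intro x L q a R q' τ h _ ih
    exact .left h ih

theorem Exits.halts_append {E : List Γ} {q : Q} {R : List Γ} {q' : Q} {R' : List Γ}
    (h : δ.Exits E q R q' R') {x : Γ} {L : List Γ} (hL : δ.Halts L q' (x :: R')) :
    δ.Halts (E ++ x :: L) q R := by
  induction h with
  | exit hd => exact .left hd hL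
  | right hd _ ih => exact .right hd (ih hL)
  | left hd _ ih => exact .left hd (ih hL)

/-- A halting computation starting in a piece of tape halts there or leaves it to the left (leaving
it to the right is not possible, since it contains the right end of the tape). -/
theorem halts_or_exits {t : ℕ} {E L : List Γ} {q : Q} {R : List Γ}
    (h : δ.haltsWithin t (E ++ L) q R = true) :
    δ.Halts E q R ∨ ∃ q' R' x L' t', L = x :: L' ∧ δ.Exits E q R q' R' ∧
      δ.haltsWithin t' L' q' (x :: R') = true ∧ t' < t := by
  induction t generalizing E q R with
  | zero => simp [haltsWithin] at h
  | succ t ih =>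
    obtain ⟨a, S, rfl, hd | ⟨q', τ, hd, h'⟩ | ⟨q', τ, x, L', hL, hd, h'⟩⟩ :=
      haltsWithin_succ_cases h
    · exact Or.inl (.of_none hd)
    · rw [← List.cons_append] at h'
      obtain h' | ⟨p, R', x, L', t', rfl, hE, ht, hlt⟩ := ih h'
      · exact Or.inl (.right hd h')
      · exact Or.inr ⟨p, R', x, L', t', rfl, .right hd hE, ht, hlt.trans t.lt_succ_self⟩
    · cases E with
      | nil => exact Or.inr ⟨q', τ :: S, x, L', t, hL, .exit hd, h', t.lt_succ_self⟩
      | cons y E =>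
        obtain ⟨rfl, rfl⟩ : y = x ∧ E ++ L = L' := by simpa using hL
        obtain h' | ⟨p, R', x, L', t', rfl, hE, ht, hlt⟩ := ih h'
        · exact Or.inl (.left hd h')
        · exact Or.inr ⟨p, R', x, L', t', rfl, .left hd hE, ht, hlt.trans t.lt_succ_self⟩

/-- By determinism, the choice made in the definition of `behaviour` is immaterial. -/
theorem Exits.unique {E : List Γ} {q : Q} {R : List Γ} {q₁ q₂ : Q} {R₁ R₂ : List Γ}
    (h₁ : δ.Exits E q R q₁ R₁) (h₂ : δ.Exits E q R q₂ R₂) : q₁ = q₂ ∧ R₁ = R₂ := by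
  induction h₁ with
  | exit hd => cases h₂ <;> simp_all
  | right hd _ ih => cases h₂ <;> simp_all
  | left hd _ ih => cases h₂ <;> simp_all

/-- If each rewriting decreases the rank, then so does the rewriting of the leftmost cell in a
computation that leaves the tape at this cell. -/
theorem Exits.rank_lt {r : Γ → ℕ} (hr : ∀ p a q τ d, δ p a = some (q, τ, d) → r τ < r a)
    {E : List Γ} {q : Q} {R : List Γ} {q' : Q} {R' : List Γ} (h : δ.Exits E q R q' R') :
    ∃ a S b S', E.reverse ++ R = a :: S ∧ R' = b :: S' ∧ r b < r a := by
  induction h with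
  | @exit q a R q' τ hd => exact ⟨a, R, τ, R, rfl, rfl, hr _ _ _ _ _ hd⟩
  | @right L q a R q' τ p S hd _ ih =>
    obtain ⟨c, T, b, S', h₁, rfl, hlt⟩ := ih
    -- The scanned cell is the leftmost one exactly when `L` is empty. Only then does this step
    -- itself lower the rank in question; otherwise the bound is inherited.
    rcases hL : L.reverse with _ | ⟨y, U⟩
    · simp only [List.reverse_cons, hL, List.nil_append, List.cons_append, List.cons.injEq] at h₁
      exact ⟨a, R, b, S', rfl, rfl, hlt.trans (h₁.1 ▸ hr _ _ _ _ _ hd)⟩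
    · simp only [List.reverse_cons, hL, List.cons_append, List.cons.injEq] at h₁
      exact ⟨y, U ++ a :: R, b, S', rfl, rfl, h₁.1 ▸ hlt⟩
  | @left x L q a R q' τ p S hd _ ih =>
    obtain ⟨c, T, b, S', h₁, rfl, hlt⟩ := ih
    rcases hL : L.reverse with _ | ⟨y, U⟩
    · simp only [hL, List.nil_append, List.cons.injEq] at h₁
      exact ⟨x, a :: R, b, S', by simp [hL], rfl, h₁.1 ▸ hlt⟩
    · simp only [hL, List.cons_append, List.cons.injEq] at h₁
      exact ⟨y, U ++ x :: a :: R, b, S', by simp [hL], rfl, h₁.1 ▸ hlt⟩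

/-! ### Behaviours of right parts of the tape -/

/-- Possible behaviours of a right part of the tape during `k` visits of the head: for each entry
state, `some none` if the computation halts during the visit, `some (some (q, β))` if it leaves the
part in state `q` with behaviour `β` during the other `k - 1` visits, and `none` otherwise. -/
def Behaviour.{u} (Q : Type u) : ℕ → Type u
  | 0 => PUnit
  | k + 1 => Q → Option (Option (Q × Behaviour Q k))

instance Behaviour.finite [Finite Q] : ∀ k, Finite (Behaviour Q k)
  | 0 => inferInstanceAs (Finite PUnit)
  | k + 1 =>
    haveI := Behaviour.finite k
    inferInstanceAs (Finite (Q → Option (Option (Q × Behaviour Q k))))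

/-- The number of behaviours for `n` states and `k` visits. -/
def numBehaviours (n k : ℕ) : ℕ :=
  k.rec 1 fun _ N => (n * N + 2) ^ n

theorem card_behaviour [Finite Q] (k : ℕ) :
    Nat.card (Behaviour Q k) = numBehaviours (Nat.card Q) k := by
  induction k with
  | zero => exact Nat.card_unique (α := PUnit)
  | succ k ih =>
    change Nat.card (Q → Option (Option (Q × Behaviour Q k))) =
      (Nat.card Q * numBehaviours (Nat.card Q) k + 2) ^ Nat.card Q
    rw [Nat.card_fun, Finite.card_option, Finite.card_option, Nat.card_prod, ih]

variable (δ) in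
open Classical in
/-- The behaviour of the right part `R` of the tape during `k` visits of the head. -/
noncomputable def behaviour : (k : ℕ) → List Γ → Behaviour Q k
  | 0, _ => PUnit.unit
  | k + 1, R => fun q =>
    if δ.Halts [] q R then some none
    else if h : ∃ x : Q × List Γ, δ.Exits [] q R x.1 x.2 then
      some (some (h.choose.1, behaviour k h.choose.2))
    else none

open Classical in
theorem behaviour_succ (k : ℕ) (R : List Γ) (q : Q) :
    δ.behaviour (k + 1) R q = if δ.Halts [] q R then some none
      else if h : ∃ x : Q × List Γ, δ.Exits [] q R x.1 x.2 then
        some (some (h.choose.1, δ.behaviour k h.choose.2))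
      else none := rfl

theorem behaviour_eq_halts {k : ℕ} {R : List Γ} {q : Q} :
    (δ.behaviour (k + 1) R q = some none) ↔ δ.Halts [] q R := by
  rw [behaviour_succ]
  split_ifs <;> simp_all

theorem behaviour_eq_exits {k : ℕ} {R : List Γ} {q q' : Q} {R' : List Γ}
    (hn : ¬ δ.Halts [] q R) (h : δ.Exits [] q R q' R') :
    δ.behaviour (k + 1) R q = some (some (q', δ.behaviour k R')) := by
  have hex : ∃ x : Q × List Γ, δ.Exits [] q R x.1 x.2 := ⟨(q', R'), h⟩
  rw [behaviour_succ, if_neg hn, dif_pos hex]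
  obtain ⟨h₁, h₂⟩ := hex.choose_spec.unique h
  rw [h₁, h₂]

theorem exits_of_behaviour_eq {k : ℕ} {R : List Γ} {q q' : Q} {β : Behaviour Q k}
    (h : δ.behaviour (k + 1) R q = some (some (q', β))) :
    ∃ R', δ.Exits [] q R q' R' ∧ δ.behaviour k R' = β := by
  rw [behaviour_succ] at h
  split_ifs at h with h₁ h₂
  · simp at h
  · obtain ⟨hq, hβ⟩ := Prod.mk.inj (Option.some.inj (Option.some.inj h))
    exact ⟨h₂.choose.2, hq ▸ h₂.choose_spec, hβ⟩

/-- Right parts of the tape with the same behaviour are interchangeable in halting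
computations. -/
theorem haltsWithin.replace {r : Γ → ℕ} (hr : ∀ p a q τ d, δ p a = some (q, τ, d) → r τ < r a)
    {k : ℕ} {R R' : List Γ} (hk : ∀ a ∈ R.head?, r a < k)
    (hR : δ.behaviour k R = δ.behaviour k R') {t : ℕ} {L : List Γ} {q : Q} {u : List Γ}
    (h : δ.haltsWithin t L q (u ++ R) = true) : δ.Halts L q (u ++ R') := by
  -- Strong induction on time, because a whole visit to `R` is skipped at once. `R`, `R'` and `k`
  -- vary: a visit rewrites both parts and uses up one level of the behaviour. The word `u` lies
  -- between the head and the boundary.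
  induction t using Nat.strong_induction_on generalizing k R R' L q u with
  | _ t ih =>
    cases u with
    | nil =>
      obtain h' | ⟨q', R₁, x, L', t', rfl, hE, ht, hlt⟩ := halts_or_exits (E := []) h
      · cases k with
        | zero =>
          -- No rank is below `0`, so `R` would be empty, and nothing halts on an empty right part.
          refine absurd hk ?_
          refine h'.rec_on (P := fun L q R => ¬ ∀ a ∈ R.head?, r a < 0) ?_ ?_ ?_ <;> simp
        | succ k =>
          have := behaviour_eq_halts.1 ((congrFun hR q).symm.trans (behaviour_eq_halts.2 h'))
          simpa using this.append L []
      · obtain ⟨a, S, b, S', ha, rfl, hb⟩ := hE.rank_lt hr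
        obtain rfl : R = a :: S := by simpa using ha
        replace hk : r a < k := hk a rfl
        cases k with
        | zero => simp at hk
        | succ k =>
          -- Halting and leaving exclude each other, but treating both cases avoids a proof of this:
          -- `behaviour` tests halting first.
          by_cases hn : δ.Halts [] q (a :: S)
          · have := behaviour_eq_halts.1 ((congrFun hR q).symm.trans (behaviour_eq_halts.2 hn))
            simpa using this.append (x :: L') []
          · obtain ⟨R₂, hE₂, hβ⟩ :=
              exits_of_behaviour_eq ((congrFun hR q).symm.trans (behaviour_eq_exits hn hE))
            -- After the visit the head is on `x`, just left of the boundary. The first cell of the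
            -- rewritten part now has rank below `k`, one less than before.
            refine hE₂.halts_append (E := []) (ih t' hlt (u := [x]) ?_ hβ.symm ht)
            intro c hc
            obtain rfl : b = c := by simpa using hc
            omega
    | cons a u =>
      cases t with
      | zero => simp [haltsWithin] at h
      | succ t =>
        obtain ⟨c, S, hS, hd | ⟨q', τ, hd, h'⟩ | ⟨q', τ, x, L', rfl, hd, h'⟩⟩ :=
          haltsWithin_succ_cases h
        all_goals obtain ⟨rfl, rfl⟩ : a = c ∧ u ++ R = S := by simpa using hS
        · exact .of_none hd
        · exact .right hd (ih t t.lt_succ_self hk hR h')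
        · exact .left hd (ih t t.lt_succ_self (u := x :: τ :: u) hk hR h')

theorem Halts.replace {r : Γ → ℕ} (hr : ∀ p a q τ d, δ p a = some (q, τ, d) → r τ < r a)
    {k : ℕ} (hk : ∀ a, r a < k) {L : List Γ} {q : Q} {u R R' : List Γ}
    (hR : δ.behaviour k R = δ.behaviour k R') (h : δ.Halts L q (u ++ R)) :
    δ.Halts L q (u ++ R') :=
  haltsWithin.replace hr (fun a _ => hk a) hR h.choose_spec

end TransFun

namespace TransFun

variable {Q Γ : Type*} {δ : TransFun Q Γ}

/-! ### Reflection -/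

variable (δ) in
/-- The transition function with left and right exchanged. -/
def mirror : TransFun Q Γ := fun q a => (δ q a).map fun x => (x.1, x.2.1, !x.2.2)

theorem mirror_mirror : δ.mirror.mirror = δ := by
  funext q a
  simp [mirror, Function.comp_def]

theorem mirror_rank_lt {r : Γ → ℕ} (hr : ∀ p a q τ d, δ p a = some (q, τ, d) → r τ < r a)
    (p : Q) (a : Γ) (q : Q) (τ : Γ) (d : Bool) (h : δ.mirror p a = some (q, τ, d)) :
    r τ < r a := by
  obtain ⟨⟨q', τ', d'⟩, h₁, h₂⟩ := Option.map_eq_some_iff.1 h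
  obtain ⟨-, rfl, -⟩ : q' = q ∧ τ' = τ ∧ (!d') = d := by simpa using h₂
  exact hr _ _ _ _ _ h₁

/-- The scanned cell always belongs to the right list, so reflection exchanges `L` and `R` but keeps
`a` at the front of the right list. -/
theorem Halts.mirror {L : List Γ} {q : Q} {a : Γ} {R : List Γ} (h : δ.Halts L q (a :: R)) :
    δ.mirror.Halts R q (a :: L) := by
  suffices ∀ b S, a :: R = b :: S → δ.mirror.Halts S q (b :: L) from this a R rfl
  refine h.rec_on (P := fun L q R => ∀ b S, R = b :: S → δ.mirror.Halts S q (b :: L)) ?_ ?_ ?_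
  · rintro L q a R hd b S ⟨⟩
    exact .of_none (by simp [TransFun.mirror, hd])
  · rintro L q a R q' τ hd h ih b S ⟨⟩
    cases R with
    | nil => exact absurd h.choose_spec (by cases h.choose <;> simp [haltsWithin])
    | cons x R => exact .left (by simp [TransFun.mirror, hd]) (ih _ _ rfl)
  · rintro x L q a R q' τ hd h ih b S ⟨⟩
    exact .right (by simp [TransFun.mirror, hd]) (ih _ _ rfl)

theorem halts_mirror_iff {L : List Γ} {q : Q} {a : Γ} {R : List Γ} :
    δ.mirror.Halts R q (a :: L) ↔ δ.Halts L q (a :: R) :=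
  ⟨fun h => mirror_mirror (δ := δ) ▸ h.mirror, Halts.mirror⟩

/-! ### Bounds for the space and for the length of the input -/

/-- Pigeonhole: the `N + 1` indices `0, …, N` exceed the number of behaviours. -/
theorem exists_behaviour_eq [Finite Q] (k : ℕ) (f : ℕ → List Γ) {N : ℕ}
    (hN : numBehaviours (Nat.card Q) k ≤ N) :
    ∃ i j, i < j ∧ j ≤ N ∧ δ.behaviour k (f i) = δ.behaviour k (f j) := by
  have := Fintype.ofFinite (Behaviour Q k)
  obtain ⟨i, j, hne, hij⟩ := Fintype.exists_ne_map_eq_of_card_lt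
    (fun i : Fin (N + 1) => δ.behaviour k (f i))
    (by rw [Fintype.card_fin, ← Nat.card_eq_fintype_card, card_behaviour]; omega)
  obtain h | h := lt_or_gt_of_ne hne
  · exact ⟨i, j, h, j.is_le, hij⟩
  · exact ⟨j, i, h, i.is_le, hij.symm⟩

/-- If a computation halts with some constant padding to the right, then it does so with a
padding of bounded length. -/
theorem Halts.replicate_right [Finite Q] {r : Γ → ℕ}
    (hr : ∀ p a q τ d, δ p a = some (q, τ, d) → r τ < r a) {k : ℕ} (hk : ∀ a, r a < k)
    {L : List Γ} {q : Q} {u : List Γ} {b : Γ} {s : ℕ}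
    (h : δ.Halts L q (u ++ List.replicate s b)) :
    δ.Halts L q (u ++ List.replicate (numBehaviours (Nat.card Q) k) b) := by
  obtain ⟨i, j, hij, hj, hb⟩ := exists_behaviour_eq (δ := δ) k (List.replicate · b)
    (le_refl (numBehaviours (Nat.card Q) k))
  induction s using Nat.strong_induction_on with
  | _ s ih =>
    obtain hs | hs := le_or_gt s (numBehaviours (Nat.card Q) k)
    · obtain ⟨t, ht⟩ := Nat.exists_eq_add_of_le hs
      rw [ht, List.replicate_add, ← List.append_assoc]
      simpa only [List.append_nil] using h.append [] (List.replicate t b)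
    · obtain ⟨t, rfl⟩ : ∃ t, s = t + j := ⟨s - j, by omega⟩
      refine ih (t + i) (by omega) ?_
      rw [List.replicate_add, ← List.append_assoc] at h ⊢
      exact h.replace hr hk hb.symm

theorem Halts.replicate_left [Finite Q] {r : Γ → ℕ}
    (hr : ∀ p a q τ d, δ p a = some (q, τ, d) → r τ < r a) {k : ℕ} (hk : ∀ a, r a < k)
    {R : List Γ} {q : Q} {b : Γ} {s : ℕ} (h : δ.Halts (List.replicate s b) q R) :
    δ.Halts (List.replicate (numBehaviours (Nat.card Q) k) b) q R := by
  cases R with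
  | nil => exact absurd h.choose_spec (by cases h.choose <;> simp [haltsWithin])
  | cons a R =>
    rw [← halts_mirror_iff] at h ⊢
    exact Halts.replicate_right (mirror_rank_lt hr) hk (u := [a]) h

/-- If a computation on finite tapes halts for each input of bounded length, then it does so for
each input. -/
theorem halts_of_forall_length_le [Finite Q] {r : Γ → ℕ}
    (hr : ∀ p a q τ d, δ p a = some (q, τ, d) → r τ < r a) {k : ℕ} (hk : ∀ a, r a < k)
    {L : List Γ} {q : Q} {S : List Γ} {A : Set Γ}
    (h : ∀ w : List Γ, w.length ≤ numBehaviours (Nat.card Q) k → (∀ a ∈ w, a ∈ A) →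
      δ.Halts L q (w ++ S)) (w : List Γ) (hw : ∀ a ∈ w, a ∈ A) : δ.Halts L q (w ++ S) := by
  induction hl : w.length using Nat.strong_induction_on generalizing w with
  | _ l ih =>
    subst hl
    obtain hs | hs := le_or_gt w.length (numBehaviours (Nat.card Q) k)
    · exact h w hs hw
    · obtain ⟨i, j, hij, hj, hb⟩ := exists_behaviour_eq (δ := δ) k (fun i => w.drop i ++ S)
        (le_refl (numBehaviours (Nat.card Q) k))
      -- The shorter word without the factor between positions `i` and `j` halts by induction.
      -- Replacing its tail `w.drop j ++ S` by `w.drop i ++ S` restores `w`.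
      have key := ih _ ?_ (w.take i ++ w.drop j) ?_ rfl
      · rw [List.append_assoc] at key
        have := key.replace hr hk hb.symm
        rwa [← List.append_assoc, List.take_append_drop] at this
      · simp only [List.length_append, List.length_take, List.length_drop]
        omega
      · intro a ha
        obtain ha | ha := List.mem_append.1 ha
        · exact hw a (List.mem_of_mem_take ha)
        · exact hw a (List.mem_of_mem_drop ha)

/-! ### Bound for the running time -/

theorem haltsWithin_mono {t t' : ℕ} (htt : t ≤ t') {L : List Γ} {q : Q} {R : List Γ}
    (h : δ.haltsWithin t L q R = true) : δ.haltsWithin t' L q R = true := by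
  induction t generalizing t' L q R with
  | zero => simp [haltsWithin] at h
  | succ t ih =>
    obtain ⟨t', rfl⟩ : ∃ s, t' = s + 1 := ⟨t' - 1, by omega⟩
    have htt := Nat.le_of_succ_le_succ htt
    obtain ⟨a, S, rfl, hd | ⟨q', τ, hd, h'⟩ | ⟨q', τ, x, L', rfl, hd, h'⟩⟩ :=
      haltsWithin_succ_cases h
    · simp [haltsWithin, hd]
    · simpa [haltsWithin, hd] using ih htt h'
    · simpa [haltsWithin, hd] using ih htt h'

/-- Each step rewrites one cell and so lowers the sum of all ranks by at least one. The extra `1` is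
there because `haltsWithin t` allows fewer than `t` steps. -/
theorem Halts.haltsWithin_sum {r : Γ → ℕ}
    (hr : ∀ p a q τ d, δ p a = some (q, τ, d) → r τ < r a) {L : List Γ} {q : Q} {R : List Γ}
    (h : δ.Halts L q R) :
    δ.haltsWithin ((L.map r).sum + (R.map r).sum + 1) L q R = true := by
  refine h.rec_on
    (P := fun L q R => δ.haltsWithin ((L.map r).sum + (R.map r).sum + 1) L q R = true) ?_ ?_ ?_
  · intro L q a R hd
    simp [haltsWithin, hd]
  · intro L q a R q' τ hd _ ih
    have := hr _ _ _ _ _ hd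
    simp only [haltsWithin, hd]
    refine haltsWithin_mono ?_ ih
    simp only [List.map_cons, List.sum_cons]
    omega
  · intro x L q a R q' τ hd _ ih
    have := hr _ _ _ _ _ hd
    simp only [haltsWithin, hd]
    refine haltsWithin_mono ?_ ih
    simp only [List.map_cons, List.sum_cons]
    omega

/-- Halting computations on a finite piece of tape take linear time. -/
theorem Halts.haltsWithin_mul {r : Γ → ℕ}
    (hr : ∀ p a q τ d, δ p a = some (q, τ, d) → r τ < r a) {k : ℕ} (hk : ∀ a, r a < k)
    {L : List Γ} {q : Q} {R : List Γ} (h : δ.Halts L q R) :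
    δ.haltsWithin ((L.length + R.length) * k + 1) L q R = true := by
  have hsum (l : List Γ) : (l.map r).sum ≤ l.length * k := by
    simpa using List.sum_le_card_nsmul (l.map r) k fun x hx => by
      obtain ⟨a, -, rfl⟩ := List.mem_map.1 hx
      exact (hk a).le
  refine haltsWithin_mono ?_ (h.haltsWithin_sum hr)
  rw [add_mul]
  exact Nat.succ_le_succ (add_le_add (hsum L) (hsum R))

/-! ### Renaming states and symbols -/

/-- This transfers the simulation on natural numbers, driven by a table, to the machine on `Fin n`
and `Fin m`. The renamings need not be injective. -/
theorem haltsWithin_map {Q' Γ' : Type*} {δ' : TransFun Q' Γ'} (g : Q → Q') (f : Γ → Γ')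
    (h : ∀ q a, δ' (g q) (f a) = (δ q a).map fun x => (g x.1, f x.2.1, x.2.2))
    (t : ℕ) (L : List Γ) (q : Q) (R : List Γ) :
    δ'.haltsWithin t (L.map f) (g q) (R.map f) = δ.haltsWithin t L q R := by
  induction t generalizing L q R with
  | zero => rfl
  | succ t ih =>
    cases R with
    | nil => rfl
    | cons a R =>
      rcases hd : δ q a with _ | ⟨q', τ, _ | _⟩
      · simp [haltsWithin, h, hd]
      · cases L with
        | nil => simp [haltsWithin, h, hd]
        | cons x L => simpa [haltsWithin, h, hd] using ih L q' (x :: τ :: R)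
      · simpa [haltsWithin, h, hd] using ih (τ :: L) q' R

end TransFun

namespace DTM

variable {Q Γ : Type*}

/-! ### Machines on bi-infinite tapes and on finite pieces of tape -/

/-- The transition function of a machine, with moves coded by `false` (left) and `true` (right). -/
def transFun (M : DTM Q Γ) : TransFun Q Γ := fun q a =>
  (M.δ q a).map fun x => (x.1, x.2.1, decide (x.2.2 = Turing.Dir.right))

/-- The configuration `c` has state `q`, and near the head its tape has the contents `L` (to the
left, nearest symbol first) and `R` (from the head on). -/
def Cfg.Shows (c : Cfg Q Γ) (L : List Γ) (q : Q) (R : List Γ) : Prop :=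
  c.state = q ∧ (∀ i (h : i < L.length), c.tape (c.head - 1 - i) = L[i]) ∧
    ∀ i (h : i < R.length), c.tape (c.head + i) = R[i]

variable {M : DTM Q Γ}

theorem Cfg.Shows.move_right {c : Cfg Q Γ} {L : List Γ} {q : Q} {a : Γ} {R : List Γ}
    (h : c.Shows L q (a :: R)) (q' : Q) (τ : Γ) :
    (⟨q', c.head + 1, Function.update c.tape c.head τ⟩ : Cfg Q Γ).Shows (τ :: L) q' R := by
  obtain ⟨-, hL, hR⟩ := h
  refine ⟨rfl, fun i hi => ?_, fun i hi => ?_⟩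
  · cases i with
    | zero => simp
    | succ i =>
      have := hL i (by simpa using hi)
      dsimp only
      rw [Function.update_of_ne (by push_cast; omega)]
      simp only [List.getElem_cons_succ, ← this]
      congr 1
      push_cast
      ring
  · have := hR (i + 1) (by simpa using hi)
    dsimp only
    rw [Function.update_of_ne (by omega)]
    simp only [List.getElem_cons_succ] at this
    rw [← this]
    congr 1
    push_cast
    ring

theorem Cfg.Shows.move_left {c : Cfg Q Γ} {x : Γ} {L : List Γ} {q : Q} {a : Γ} {R : List Γ}
    (h : c.Shows (x :: L) q (a :: R)) (q' : Q) (τ : Γ) :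
    (⟨q', c.head - 1, Function.update c.tape c.head τ⟩ : Cfg Q Γ).Shows L q' (x :: τ :: R) := by
  obtain ⟨-, hL, hR⟩ := h
  refine ⟨rfl, fun i hi => ?_, fun i hi => ?_⟩
  · have := hL (i + 1) (by simpa using hi)
    dsimp only
    rw [Function.update_of_ne (by omega)]
    simp only [List.getElem_cons_succ] at this
    rw [← this]
    congr 1
    push_cast
    ring
  · match i, hi with
    | 0, _ =>
      have := hL 0 (by simp)
      dsimp only
      rw [Function.update_of_ne (by simp)]
      simpa using this
    | 1, _ => simp
    | i + 2, hi =>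
      have := hR (i + 1) (by simpa using hi)
      dsimp only
      rw [Function.update_of_ne (by push_cast; omega)]
      simp only [List.getElem_cons_succ] at this ⊢
      rw [← this]
      congr 1
      push_cast
      ring

theorem Cfg.Shows.tape_head {c : Cfg Q Γ} {L : List Γ} {q : Q} {a : Γ} {R : List Γ}
    (h : c.Shows L q (a :: R)) : c.tape c.head = a := by
  have := h.2.2 0 (by simp)
  rwa [Nat.cast_zero, add_zero] at this

theorem transFun_eq_none {q : Q} {a : Γ} : M.transFun q a = none ↔ M.δ q a = none := by
  simp [transFun]

theorem transFun_eq_some {q q' : Q} {a τ : Γ} {d : Bool} :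
    M.transFun q a = some (q', τ, d) ↔
      M.δ q a = some (q', τ, if d then Turing.Dir.right else Turing.Dir.left) := by
  rcases h : M.δ q a with _ | ⟨p, σ, _ | _⟩ <;> cases d <;> simp [transFun, h]

theorem exists_isHalting_of_halts {L : List Γ} {q : Q} {R : List Γ}
    (h : M.transFun.Halts L q R) {c : Cfg Q Γ} (hc : c.Shows L q R) :
    ∃ c', Relation.ReflTransGen M.Yields c c' ∧ M.IsHalting c' := by
  refine h.rec_on (P := fun L q R => ∀ c : Cfg Q Γ, c.Shows L q R →
    ∃ c', Relation.ReflTransGen M.Yields c c' ∧ M.IsHalting c') ?_ ?_ ?_ c hc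
  · intro L q a R hd c hc
    refine ⟨c, .refl, ?_⟩
    rintro c' ⟨q', τ, d, h, -⟩
    rw [hc.1, hc.tape_head, transFun_eq_none.1 hd] at h
    cases h
  · intro L q a R q' τ hd _ ih c hc
    obtain ⟨c', h₁, h₂⟩ := ih _ (hc.move_right q' τ)
    refine ⟨c', .head ⟨q', τ, .right, ?_, rfl⟩ h₁, h₂⟩
    rw [hc.1, hc.tape_head]
    exact transFun_eq_some.1 hd
  · intro x L q a R q' τ hd _ ih c hc
    obtain ⟨c', h₁, h₂⟩ := ih _ (hc.move_left q' τ)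
    refine ⟨c', .head ⟨q', τ, .left, ?_, rfl⟩ h₁, h₂⟩
    rw [hc.1, hc.tape_head]
    exact transFun_eq_some.1 hd

/-- The head moves one cell per step, so a margin of one cell more than the number of steps on both
sides is never left. -/
theorem exists_halts_of_isHalting {c c' : Cfg Q Γ} (h : Relation.ReflTransGen M.Yields c c')
    (hc' : M.IsHalting c') :
    ∃ s, ∀ L q R, s ≤ L.length → s ≤ R.length → c.Shows L q R → M.transFun.Halts L q R := by
  induction h using Relation.ReflTransGen.head_induction_on with
  | refl =>
    refine ⟨1, fun L q R _ hR hc => ?_⟩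
    obtain ⟨a, R, rfl⟩ := List.exists_cons_of_length_pos hR
    refine .of_none (transFun_eq_none.2 ?_)
    rcases hd : M.δ q a with _ | ⟨q', τ, d⟩
    · rfl
    · exact absurd ⟨q', τ, d, by rw [hc.1, hc.tape_head, hd], rfl⟩ (hc' _)
  | @head c₁ c₂ hy _ ih =>
    obtain ⟨s, hs⟩ := ih
    obtain ⟨q', τ, d, hd, rfl⟩ := hy
    refine ⟨s + 1, fun L q R hL hR hc => ?_⟩
    obtain ⟨a, R, rfl⟩ := List.exists_cons_of_length_pos (s.succ_pos.trans_le hR)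
    obtain ⟨x, L, rfl⟩ := List.exists_cons_of_length_pos (s.succ_pos.trans_le hL)
    simp only [List.length_cons] at hL hR
    rw [hc.1, hc.tape_head] at hd
    cases d with
    | left =>
      exact .left (transFun_eq_some.2 hd)
        (hs _ _ _ (by omega) (by simp only [List.length_cons]; omega) (hc.move_left q' τ))
    | right =>
      exact .right (transFun_eq_some.2 hd)
        (hs _ _ _ (by simp only [List.length_cons]; omega) (by omega) (hc.move_right q' τ))

theorem shows_initCfg (M : DTM Q Γ) (w : List Γ) (s s' : ℕ) :
    (M.initCfg w).Shows (List.replicate s M.blank) M.start (w ++ List.replicate s' M.blank) := by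
  refine ⟨rfl, fun i hi => ?_, fun i hi => ?_⟩
  · simp only [initCfg, initTape, List.getElem_replicate]
    rw [if_neg (by omega)]
  · simp only [initCfg, initTape, zero_add, Int.toNat_natCast]
    rw [if_pos (by omega), List.getElem_append]
    split_ifs with h
    · simp [h]
    · simp [not_lt.1 h]

theorem haltsOn_iff (w : List Γ) : M.HaltsOn w ↔ ∃ s s',
    M.transFun.Halts (List.replicate s M.blank) M.start (w ++ List.replicate s' M.blank) := by
  constructor
  · rintro ⟨c, h, hc⟩
    obtain ⟨s, hs⟩ := exists_halts_of_isHalting h hc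
    exact ⟨s, s, hs _ _ _ (by simp) (by simp) (shows_initCfg M w s s)⟩
  · rintro ⟨s, s', h⟩
    exact exists_isHalting_of_halts h (shows_initCfg M w s s')

/-- Each rewriting decreases the rank `r`. -/
def ReducesRank (M : DTM Q Γ) (r : Γ → ℕ) : Prop :=
  ∀ p σ q τ d, M.transFun p σ = some (q, τ, d) → r τ < r σ

theorem isWeightReducing_iff [Finite Γ] :
    M.IsWeightReducing ↔ ∃ r : Γ → ℕ, (∀ a, r a < Nat.card Γ) ∧ M.ReducesRank r := by
  constructor
  · rintro ⟨lt, hlt, h⟩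
    have hlt' {τ σ : Γ} (hts : lt τ σ) : {a | lt a τ} ⊂ {a | lt a σ} :=
      ⟨fun a (ha : lt a τ) => hlt.trans _ _ _ ha hts, fun hs => hlt.irrefl τ (hs hts)⟩
    -- The rank of `a` is the number of symbols below it. It is less than the size of the alphabet
    -- because `a` is not below itself.
    refine ⟨fun a => {x | lt x a}.ncard, fun a => ?_, fun p σ q τ d hd => ?_⟩
    · rw [← Set.ncard_univ]
      refine Set.ncard_lt_ncard ⟨Set.subset_univ _, fun hs => ?_⟩ (Set.toFinite _)
      exact hlt.irrefl a (hs (Set.mem_univ a))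
    · exact Set.ncard_lt_ncard (hlt' (h _ _ _ _ _ (transFun_eq_some.1 hd))) (Set.toFinite _)
  · rintro ⟨r, -, h⟩
    refine ⟨fun a b => r a < r b, ⟨⟩, fun p σ q τ d hd => ?_⟩
    refine h p σ q τ (decide (d = Turing.Dir.right)) (transFun_eq_some.2 ?_)
    cases d <;> simpa using hd

/-- For a weight-reducing machine, halting on each input is a matter of finitely many computations
on finite pieces of tape. -/
theorem ReducesRank.haltsOnEveryInput_iff [Finite Q] {r : Γ → ℕ} (hr : M.ReducesRank r) {k : ℕ}
    (hk : ∀ a, r a < k) {N : ℕ} (hN : N = TransFun.numBehaviours (Nat.card Q) k) :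
    M.HaltsOnEveryInput ↔ ∀ w : List Γ, w.length ≤ N → (∀ a ∈ w, a ∈ M.inputAlphabet) →
      M.transFun.haltsWithin ((N + (w.length + N)) * k + 1) (List.replicate N M.blank) M.start
        (w ++ List.replicate N M.blank) = true := by
  -- The padding `N` does not depend on `w`; therefore the bound for the input length applies with
  -- fixed surroundings of the word.
  have key (w : List Γ) : M.HaltsOn w ↔
      M.transFun.Halts (List.replicate N M.blank) M.start (w ++ List.replicate N M.blank) := by
    rw [haltsOn_iff]
    constructor
    · rintro ⟨s, s', h⟩
      rw [hN]
      exact (h.replicate_right hr hk).replicate_left hr hk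
    · exact fun h => ⟨N, N, h⟩
  simp only [HaltsOnEveryInput, key]
  constructor
  · intro h w _ hw
    simpa using (h w hw).haltsWithin_mul hr hk
  · intro h w hw
    exact TransFun.halts_of_forall_length_le hr hk
      (fun w hl hw => ⟨_, h w (hN ▸ hl) hw⟩) w hw

end DTM

namespace TransFun

/-! ### Computability of the simulation -/

section Step

variable {Q Γ : Type*} (δ : TransFun Q Γ)

/-- One step on a finite piece of tape. The scanned symbol is lost when the head leaves the piece
of tape. -/
def step (z : List Γ × Q × List Γ) : List Γ × Q × List Γ :=
  match z with
  | (L, q, []) => (L, q, [])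
  | (L, q, a :: R) =>
    match δ q a with
    | none => (L, q, a :: R)
    | some (q', τ, true) => (τ :: L, q', R)
    | some (q', τ, false) =>
      match L with
      | [] => ([], q', [])
      | x :: L' => (L', q', x :: τ :: R)

/-- Whether no transition is applicable, the head being on the piece of tape. -/
def stopped (z : List Γ × Q × List Γ) : Bool :=
  match z with
  | (_, _, []) => false
  | (_, q, a :: _) => (δ q a).isNone

variable {δ}

/-- Stopped configurations and those off the tape are fixed by `step`, so inspecting the
configuration after exactly `t` steps suffices. This turns a recursion with changing arguments into
the iteration of one function, for which primitive recursiveness is direct. -/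
theorem haltsWithin_succ (t : ℕ) (L : List Γ) (q : Q) (R : List Γ) :
    δ.haltsWithin (t + 1) L q R = δ.stopped (δ.step^[t] (L, q, R)) := by
  have hfix {z : List Γ × Q × List Γ} (hz : δ.step z = z) (t : ℕ) : δ.step^[t] z = z :=
    Function.iterate_fixed hz t
  induction t generalizing L q R with
  | zero =>
    cases R with
    | nil => rfl
    | cons a R =>
      rcases hd : δ q a with _ | ⟨q', τ, _ | _⟩
      · simp [haltsWithin, stopped, hd]
      · cases L <;> simp [haltsWithin, stopped, hd]
      · simp [haltsWithin, stopped, hd]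
  | succ t ih =>
    rw [Function.iterate_succ_apply]
    cases R with
    | nil => rw [hfix rfl]; rfl
    | cons a R =>
      rcases hd : δ q a with _ | ⟨q', τ, _ | _⟩
      · have hs : δ.step (L, q, a :: R) = (L, q, a :: R) := by simp [step, hd]
        rw [hs, hfix hs]
        simp [haltsWithin, stopped, hd]
      · cases L with
        | nil =>
          have hs : δ.step ([], q, a :: R) = ([], q', []) := by simp [step, hd]
          rw [hs, hfix rfl]
          simp [haltsWithin, stopped, hd]
        | cons x L =>
          have hs : δ.step (x :: L, q, a :: R) = (L, q', x :: τ :: R) := by simp [step, hd]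
          rw [hs, ← ih]
          simp [haltsWithin, hd]
      · have hs : δ.step (L, q, a :: R) = (τ :: L, q', R) := by simp [step, hd]
        rw [hs, ← ih]
        simp [haltsWithin, hd]

end Step

/-- Transition tables: one row per state, one entry per symbol. -/
abbrev Table : Type := List (List (Option (ℕ × ℕ × Bool)))

/-- The transition function given by a table. -/
def ofTable (T : Table) : TransFun ℕ ℕ := fun q a => ((T[q]?.getD [])[a]?).getD none

section Primrec

open Primrec

theorem primrec_ofTable : Primrec fun p : Table × ℕ × ℕ => ofTable p.1 p.2.1 p.2.2 :=
  option_getD.comp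
    (list_getElem?.comp
      (option_getD.comp (list_getElem?.comp fst (fst.comp snd)) (const [])) (snd.comp snd))
    (const none)

theorem primrec_ofTable_comp {α : Type*} [Primcodable α] {T : α → Table} {q a : α → ℕ}
    (hT : Primrec T) (hq : Primrec q) (ha : Primrec a) :
    Primrec fun x => ofTable (T x) (q x) (a x) :=
  primrec_ofTable.comp (hT.pair (hq.pair ha))

theorem primrec_step : Primrec₂ fun (T : Table) (z : List ℕ × ℕ × List ℕ) =>
    (ofTable T).step z := by
  have hL : Primrec fun p : Table × List ℕ × ℕ × List ℕ => p.2.1 := fst.comp snd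
  have hq : Primrec fun p : Table × List ℕ × ℕ × List ℕ => p.2.2.1 := fst.comp (snd.comp snd)
  have hR : Primrec fun p : Table × List ℕ × ℕ × List ℕ => p.2.2.2 := snd.comp (snd.comp snd)
  -- `p.1.1`: table and configuration; `p.1.2`: scanned symbol and rest; `p.2`: the action.
  have hact : Primrec fun p : ((Table × List ℕ × ℕ × List ℕ) × ℕ × List ℕ) × ℕ × ℕ × Bool =>
      cond p.2.2.2 (p.2.2.1 :: p.1.1.2.1, p.2.1, p.1.2.2)
        (List.casesOn (motive := fun _ => List ℕ × ℕ × List ℕ) p.1.1.2.1 ([], p.2.1, [])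
          fun x L => (L, p.2.1, x :: p.2.2.1 :: p.1.2.2)) := by
    have hq' : Primrec fun p : ((Table × List ℕ × ℕ × List ℕ) × ℕ × List ℕ) × ℕ × ℕ × Bool =>
      p.2.1 := fst.comp snd
    have hτ : Primrec fun p : ((Table × List ℕ × ℕ × List ℕ) × ℕ × List ℕ) × ℕ × ℕ × Bool =>
      p.2.2.1 := fst.comp (snd.comp snd)
    have hd : Primrec fun p : ((Table × List ℕ × ℕ × List ℕ) × ℕ × List ℕ) × ℕ × ℕ × Bool =>
      p.2.2.2 := snd.comp (snd.comp snd)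
    have hS : Primrec fun p : ((Table × List ℕ × ℕ × List ℕ) × ℕ × List ℕ) × ℕ × ℕ × Bool =>
      p.1.2.2 := snd.comp (snd.comp fst)
    have hL' : Primrec fun p : ((Table × List ℕ × ℕ × List ℕ) × ℕ × List ℕ) × ℕ × ℕ × Bool =>
      p.1.1.2.1 := hL.comp (fst.comp fst)
    refine Primrec.cond hd (pair (list_cons.comp hτ hL') (pair hq' hS))
      (list_casesOn (h := fun p (y : ℕ × List ℕ) => (y.2, p.2.1, y.1 :: p.2.2.1 :: p.1.2.2))
        hL' (pair (const []) (pair hq' (const []))) ?_)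
    exact (pair (snd.comp snd) (pair (hq'.comp fst)
      (list_cons.comp (fst.comp snd) (list_cons.comp (hτ.comp fst) (hS.comp fst))))).to₂
  have := list_casesOn hR snd
    (option_casesOn
      (primrec_ofTable_comp (fst.comp fst) (hq.comp fst) (fst.comp snd))
      (snd.comp fst) hact.to₂).to₂
  refine this.of_eq ?_
  rintro ⟨T, L, q, _ | ⟨a, R⟩⟩
  · rfl
  · rcases hd : ofTable T q a with _ | ⟨q', τ, _ | _⟩
    · simp [step, hd]
    · cases L <;> simp [step, hd]
    · simp [step, hd]

theorem primrec_stopped : Primrec₂ fun (T : Table) (z : List ℕ × ℕ × List ℕ) =>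
    (ofTable T).stopped z := by
  have hq : Primrec fun p : Table × List ℕ × ℕ × List ℕ => p.2.2.1 := fst.comp (snd.comp snd)
  have hR : Primrec fun p : Table × List ℕ × ℕ × List ℕ => p.2.2.2 := snd.comp (snd.comp snd)
  have := list_casesOn hR (const false)
    (Primrec.not.comp (option_isSome.comp
      (primrec_ofTable_comp (fst.comp fst) (hq.comp fst) (fst.comp snd)))).to₂
  refine this.of_eq ?_
  rintro ⟨T, L, q, _ | ⟨a, R⟩⟩
  · rfl
  · simp [stopped]

theorem primrec_haltsWithin : Primrec fun p : (Table × ℕ) × List ℕ × ℕ × List ℕ =>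
    (ofTable p.1.1).haltsWithin (p.1.2 + 1) p.2.1 p.2.2.1 p.2.2.2 := by
  refine (primrec_stopped.comp (fst.comp fst)
    (nat_iterate (snd.comp fst) snd
      (primrec_step.comp (fst.comp (fst.comp fst)) snd).to₂)).of_eq ?_
  rintro ⟨⟨T, t⟩, L, q, R⟩
  exact (haltsWithin_succ t L q R).symm

theorem primrec_haltsWithin_comp {α : Type*} [Primcodable α] {T : α → Table} {t q : α → ℕ}
    {L R : α → List ℕ} (hT : Primrec T) (ht : Primrec t) (hL : Primrec L) (hq : Primrec q)
    (hR : Primrec R) :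
    Primrec fun x => (ofTable (T x)).haltsWithin (t x + 1) (L x) (q x) (R x) :=
  primrec_haltsWithin.comp ((hT.pair ht).pair (hL.pair (hq.pair hR)))

theorem primrec_numBehaviours : Primrec₂ numBehaviours := by
  have hpow : Primrec₂ ((· ^ ·) : ℕ → ℕ → ℕ) := Primrec₂.unpaired'.1 Nat.Primrec.pow
  exact nat_rec (const 1)
    (hpow.comp
      (nat_add.comp (nat_mul.comp fst (snd.comp snd)) (const 2)) fst).to₂

end Primrec

end TransFun

/-! ### Words of a given length -/

/-- All words of length `k` over the symbols in a list. -/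
def words {α : Type*} (s : List α) (k : ℕ) : List (List α) :=
  k.rec [[]] fun _ W => W.flatMap fun w => s.map (· :: w)

theorem mem_words {α : Type*} {s : List α} {k : ℕ} {w : List α} :
    w ∈ words s k ↔ w.length = k ∧ ∀ a ∈ w, a ∈ s := by
  induction k generalizing w with
  | zero => simp +contextual [words, List.length_eq_zero_iff]
  | succ k ih =>
    change (w ∈ (words s k).flatMap fun w => s.map (· :: w)) ↔ _
    cases w with
    | nil => simp
    | cons a w => simp [ih]; tauto

theorem primrec_words {α : Type*} [Primcodable α] : Primrec₂ (@words α) := by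
  open Primrec in
  exact nat_rec (const [[]])
    (list_flatMap (snd.comp snd)
      (list_map (fst.comp fst) (list_cons.comp snd (snd.comp fst)).to₂).to₂).to₂

theorem primrec_replicate {α : Type*} [Primcodable α] : Primrec₂ (@List.replicate α) := by
  open Primrec in
  exact (list_map (list_range.comp fst) (snd.comp fst).to₂).of_eq fun p => by simp

namespace DTM

/-! ### The decision procedure -/

namespace Code

/-- The number of states. -/
def numStates (c : Code) : ℕ := c.1
/-- The number of symbols. -/
def numSymbols (c : Code) : ℕ := c.2.1
/-- The index of the blank. -/
def blank (c : Code) : ℕ := c.2.2.1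
/-- The indicator list of the input alphabet. -/
def input (c : Code) : List Bool := c.2.2.2.1
/-- The transition table. -/
def table (c : Code) : TransFun.Table := c.2.2.2.2.1
/-- The index of the initial state. -/
def start (c : Code) : ℕ := c.2.2.2.2.2.1
/-- The indicator list of the final states. -/
def final (c : Code) : List Bool := c.2.2.2.2.2.2

/-- The code describes a machine. -/
def IsValid (c : Code) : Prop :=
  c.input[c.blank]? = some false ∧ c.input.length = c.numSymbols ∧
    c.table.length = c.numStates ∧ c.start < c.numStates ∧ c.final.length = c.numStates ∧
    ∀ row ∈ c.table, row.length = c.numSymbols ∧ ∀ o ∈ row, ∀ x ∈ o.toList,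
      x.1 < c.numStates ∧ x.2.1 < c.numSymbols ∧ x.2.1 ≠ c.blank

/-- Some list of ranks below the number of symbols is decreased by each transition. -/
def HasRank (c : Code) : Prop :=
  ∃ r ∈ words (List.range c.numSymbols) c.numSymbols, ∀ q ∈ List.range c.numStates,
    ∀ a ∈ List.range c.numSymbols, ∀ x ∈ (TransFun.ofTable c.table q a).toList,
      r.getD x.2.1 0 < r.getD a 0

/-- The number of behaviours of parts of the tape. -/
def bound (c : Code) : ℕ := TransFun.numBehaviours c.numStates c.numSymbols

/-- The machine halts on each short input, within some time and space. -/
def HaltsOnShortInputs (c : Code) : Prop :=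
  ∀ k ∈ List.range (c.bound + 1), ∀ w ∈ words (List.range c.numSymbols) k,
    ¬ (∀ a ∈ w, c.input[a]? = some true) ∨
      (TransFun.ofTable c.table).haltsWithin ((c.bound + (k + c.bound)) * c.numSymbols + 1)
        (List.replicate c.bound c.blank) c.start (w ++ List.replicate c.bound c.blank) = true

section Primrec

open Primrec

theorem primrec_numStates : Primrec numStates := fst
theorem primrec_numSymbols : Primrec numSymbols := fst.comp snd
theorem primrec_blank : Primrec blank := fst.comp (snd.comp snd)
theorem primrec_input : Primrec input := fst.comp (snd.comp (snd.comp snd))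
theorem primrec_table : Primrec table := fst.comp (snd.comp (snd.comp (snd.comp snd)))
theorem primrec_start : Primrec start := fst.comp (snd.comp (snd.comp (snd.comp (snd.comp snd))))
theorem primrec_final : Primrec final := snd.comp (snd.comp (snd.comp (snd.comp (snd.comp snd))))

theorem primrec_bound : Primrec bound :=
  TransFun.primrec_numBehaviours.comp primrec_numStates primrec_numSymbols

/-- The body sees the parameter paired with the list element, so nested quantifiers collect their
context in nested pairs. -/
theorem primrecPred_forall_mem {α β : Type*} [Primcodable α] [Primcodable β] {f : α → List β}
    {p : α → β → Prop} (hf : Primrec f) (hp : PrimrecPred fun x : α × β => p x.1 x.2) :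
    PrimrecPred fun a => ∀ b ∈ f a, p a b :=
  (PrimrecRel.forall_mem_list (R := fun b a => p a b)
    (PrimrecPred.comp hp (pair snd fst))).comp hf .id

theorem primrecPred_exists_mem {α β : Type*} [Primcodable α] [Primcodable β] {f : α → List β}
    {p : α → β → Prop} (hf : Primrec f) (hp : PrimrecPred fun x : α × β => p x.1 x.2) :
    PrimrecPred fun a => ∃ b ∈ f a, p a b :=
  (PrimrecRel.exists_mem_list (R := fun b a => p a b)
    (PrimrecPred.comp hp (pair snd fst))).comp hf .id

theorem primrecPred_isValid : PrimrecPred IsValid := by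
  have hact : PrimrecPred fun p : (Code × List (Option (ℕ × ℕ × Bool))) × Option (ℕ × ℕ × Bool) =>
      ∀ x ∈ p.2.toList, x.1 < p.1.1.numStates ∧ x.2.1 < p.1.1.numSymbols ∧ x.2.1 ≠ p.1.1.blank := by
    refine primrecPred_forall_mem (optionToList.comp snd) ?_
    have hc : Primrec fun p : ((Code × List (Option (ℕ × ℕ × Bool))) × Option (ℕ × ℕ × Bool)) ×
      ℕ × ℕ × Bool => p.1.1.1 := fst.comp (fst.comp fst)
    exact .and (nat_lt.comp (fst.comp snd) (primrec_numStates.comp hc)) <|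
      .and (nat_lt.comp (fst.comp (snd.comp snd)) (primrec_numSymbols.comp hc)) <|
      .not (Primrec.eq.comp (fst.comp (snd.comp snd)) (primrec_blank.comp hc))
  have hrow : PrimrecPred fun p : Code × List (Option (ℕ × ℕ × Bool)) =>
      p.2.length = p.1.numSymbols ∧ ∀ o ∈ p.2, ∀ x ∈ o.toList,
        x.1 < p.1.numStates ∧ x.2.1 < p.1.numSymbols ∧ x.2.1 ≠ p.1.blank :=
    .and (Primrec.eq.comp (list_length.comp snd) (primrec_numSymbols.comp fst))
      (primrecPred_forall_mem snd hact)
  exact .and (Primrec.eq.comp (list_getElem?.comp primrec_input primrec_blank)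
      (const (some false))) <|
    .and (Primrec.eq.comp (list_length.comp primrec_input) primrec_numSymbols) <|
    .and (Primrec.eq.comp (list_length.comp primrec_table) primrec_numStates) <|
    .and (nat_lt.comp primrec_start primrec_numStates) <|
    .and (Primrec.eq.comp (list_length.comp primrec_final) primrec_numStates)
      (primrecPred_forall_mem primrec_table hrow)

theorem primrecPred_hasRank : PrimrecPred HasRank := by
  have hs : Primrec fun c : Code => List.range c.numSymbols := list_range.comp primrec_numSymbols
  have hact : PrimrecPred fun p : ((Code × List ℕ) × ℕ) × ℕ =>
      ∀ x ∈ (TransFun.ofTable p.1.1.1.table p.1.2 p.2).toList,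
        p.1.1.2.getD x.2.1 0 < p.1.1.2.getD p.2 0 := by
    refine primrecPred_forall_mem (optionToList.comp (TransFun.primrec_ofTable_comp
      (primrec_table.comp (fst.comp (fst.comp fst))) (snd.comp fst) snd)) ?_
    have hr : Primrec fun p : (((Code × List ℕ) × ℕ) × ℕ) × ℕ × ℕ × Bool => p.1.1.1.2 :=
      snd.comp (fst.comp (fst.comp fst))
    exact nat_lt.comp ((list_getD 0).comp hr (fst.comp (snd.comp snd)))
      ((list_getD 0).comp hr (snd.comp fst))
  exact primrecPred_exists_mem (primrec_words.comp hs primrec_numSymbols) <|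
    primrecPred_forall_mem (list_range.comp (primrec_numStates.comp fst)) <|
    primrecPred_forall_mem (hs.comp (fst.comp fst)) hact

theorem primrecPred_haltsOnShortInputs : PrimrecPred HaltsOnShortInputs := by
  have hs : Primrec fun c : Code => List.range c.numSymbols := list_range.comp primrec_numSymbols
  refine primrecPred_forall_mem (list_range.comp (nat_add.comp primrec_bound (const 1))) <|
    primrecPred_forall_mem (primrec_words.comp (hs.comp fst) snd) <| .or (.not ?_) ?_
  · exact primrecPred_forall_mem snd (Primrec.eq.comp
      (list_getElem?.comp (primrec_input.comp (fst.comp (fst.comp fst))) snd) (const _))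
  · have hc : Primrec fun p : (Code × ℕ) × List ℕ => p.1.1 := fst.comp fst
    have hN : Primrec fun p : (Code × ℕ) × List ℕ => p.1.1.bound := primrec_bound.comp hc
    have hpad : Primrec fun p : (Code × ℕ) × List ℕ => List.replicate p.1.1.bound p.1.1.blank :=
      primrec_replicate.comp hN (primrec_blank.comp hc)
    exact Primrec.eq.comp (TransFun.primrec_haltsWithin_comp (primrec_table.comp hc)
      (nat_mul.comp (nat_add.comp hN (nat_add.comp (snd.comp fst) hN)) (primrec_numSymbols.comp hc))
      hpad (primrec_start.comp hc) (list_append.comp snd hpad)) (const true)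

end Primrec

end Code

/-! ### Correctness of the decision procedure -/

/-- The transition described by `x`. -/
def decodeAction {n m : ℕ} (x : ℕ × ℕ × Bool) (h : x.1 < n ∧ x.2.1 < m) :
    Fin n × Fin m × Turing.Dir :=
  (⟨x.1, h.1⟩, ⟨x.2.1, h.2⟩, if x.2.2 then Turing.Dir.right else Turing.Dir.left)

theorem map_codeAction_pmap_decodeAction {n m : ℕ} (o : Option (ℕ × ℕ × Bool))
    (h : ∀ x ∈ o, x.1 < n ∧ x.2.1 < m) : (o.pmap decodeAction h).map codeAction = o := by
  rcases o with _ | ⟨q, τ, _ | _⟩ <;> rfl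

theorem Code.IsValid.exists_code_eq {c : Code} (hc : c.IsValid) :
    ∃ (n m : ℕ) (M : DTM (Fin n) (Fin m)), M.code = c := by
  obtain ⟨n, m, b, I, T, s, F⟩ := c
  obtain ⟨hb, hI, hT, hs, hF, hrow⟩ := hc
  dsimp only [Code.input, Code.blank, Code.numSymbols, Code.table, Code.numStates, Code.start,
    Code.final] at hb hI hT hs hF hrow
  -- Validity demands that looking up the blank yields `some false`; success of the lookup also says
  -- that the blank is in range.
  have hbm : b < m := hI ▸ (List.getElem?_eq_some_iff.1 hb).1
  have hlen (q : Fin n) : (T[q]).length = m := (hrow _ (List.getElem_mem _)).1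
  have hx (q : Fin n) (a : Fin m) : ∀ x ∈ T[q][a]'(by rw [hlen]; exact a.2),
      x.1 < n ∧ x.2.1 < m ∧ x.2.1 ≠ b := fun x hx =>
    (hrow _ (List.getElem_mem _)).2 _ (List.getElem_mem _) x (by simpa using hx)
  refine ⟨n, m, ⟨{a | I[a]? = some true}, ⟨b, hbm⟩, by simp [hb],
    fun q a => (T[q][a]'(by rw [hlen]; exact a.2)).pmap decodeAction
      fun x h => ⟨(hx q a x h).1, (hx q a x h).2.1⟩, ?_,
    ⟨s, hs⟩, {q | F[q]? = some true}⟩, ?_⟩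
  · intro p σ q τ d h
    obtain ⟨x, hp, hxm, hx'⟩ := Option.pmap_eq_some_iff.1 h
    simp only [decodeAction, Prod.mk.injEq] at hx'
    obtain ⟨-, rfl, -⟩ := hx'
    exact fun hb => (hx p σ x hxm).2.2 (congrArg Fin.val hb)
  · simp only [code, Prod.mk.injEq, true_and]
    refine ⟨?_, ?_, ?_⟩
    · refine List.ext_getElem (by simp [hI]) fun i h₁ h₂ => ?_
      simp [h₂]
    · refine List.ext_getElem (by simp [hT]) fun i h₁ h₂ => ?_
      refine List.ext_getElem ?_ fun j h₃ h₄ => ?_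
      · simpa using (hlen ⟨i, by simpa using h₁⟩).symm
      · simp only [List.getElem_ofFn, map_codeAction_pmap_decodeAction]
        rfl
    · refine List.ext_getElem (by simp [hF]) fun i h₁ h₂ => ?_
      simp [h₂]

section Correctness

variable {n m : ℕ} (M : DTM (Fin n) (Fin m))

@[simp] theorem numStates_code : M.code.numStates = n := rfl
@[simp] theorem numSymbols_code : M.code.numSymbols = m := rfl
@[simp] theorem blank_code : M.code.blank = M.blank := rfl
@[simp] theorem start_code : M.code.start = M.start := rfl

@[simp] theorem table_code : M.code.table =
    List.ofFn fun q => List.ofFn fun a => (M.δ q a).map codeAction := rfl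

open Classical in
@[simp] theorem input_code :
    M.code.input = List.ofFn fun a => decide (a ∈ M.inputAlphabet) := rfl

open Classical in
@[simp] theorem final_code : M.code.final = List.ofFn fun q => decide (q ∈ M.final) := rfl

/-- On indices in range the default values of the lookups play no role. This is the compatibility
that `haltsWithin_map` requires. -/
theorem ofTable_code (q : Fin n) (a : Fin m) :
    TransFun.ofTable M.code.table q a =
      (M.transFun q a).map fun x => ((x.1 : ℕ), (x.2.1 : ℕ), x.2.2) := by
  simp only [TransFun.ofTable, table_code, transFun, Option.map_map]
  simp
  rfl

theorem isValid_code : M.code.IsValid := by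
  refine ⟨?_, ?_, ?_, M.start.2, ?_, ?_⟩
  · simp [M.blank_notMem]
  · simp
  · simp
  · simp
  · intro row hrow
    obtain ⟨q, rfl⟩ := (List.mem_ofFn' _ _).1 hrow
    refine ⟨by simp, fun o ho x hx => ?_⟩
    obtain ⟨a, rfl⟩ := (List.mem_ofFn' _ _).1 ho
    obtain ⟨⟨q', τ, d⟩, h, rfl⟩ := Option.map_eq_some_iff.1 (Option.mem_toList.1 hx)
    exact ⟨q'.2, τ.2, fun hb => M.not_write_blank _ _ _ _ _ h (Fin.ext hb)⟩

theorem hasRank_code : M.code.HasRank ↔ M.IsWeightReducing := by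
  rw [isWeightReducing_iff, Nat.card_fin]
  constructor
  · rintro ⟨r, hr, h⟩
    obtain ⟨hl, hr⟩ := mem_words.1 hr
    refine ⟨fun a => r.getD a 0, fun a => ?_, fun p σ q τ d hd => ?_⟩
    · have ha : (a : ℕ) < r.length := hl ▸ a.2
      dsimp only
      rw [List.getD_eq_getElem _ _ ha]
      exact List.mem_range.1 (hr _ (List.getElem_mem _))
    · refine h p (List.mem_range.2 p.2) σ (List.mem_range.2 σ.2) (q, τ, d) ?_
      rw [Option.mem_toList, ofTable_code, hd]
      rfl
  · rintro ⟨r, hr, h⟩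
    refine ⟨List.ofFn r, mem_words.2 ⟨List.length_ofFn, fun a ha => ?_⟩, fun q hq a ha x hx => ?_⟩
    · obtain ⟨i, rfl⟩ := (List.mem_ofFn' _ _).1 ha
      exact List.mem_range.2 (hr i)
    · lift q to Fin n using List.mem_range.1 hq
      lift a to Fin m using List.mem_range.1 ha
      rw [ofTable_code, Option.mem_toList] at hx
      obtain ⟨⟨q', τ, d⟩, hd, rfl⟩ := Option.map_eq_some_iff.1 hx
      simpa using h _ _ _ _ _ hd

/-- Weight reduction supplies ranks below `m`, so `m` can serve as the number of visits and as the
time factor per cell. -/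
theorem haltsOnShortInputs_code (hM : M.IsWeightReducing) :
    M.code.HaltsOnShortInputs ↔ M.HaltsOnEveryInput := by
  obtain ⟨r, hk, hr⟩ := isWeightReducing_iff.1 hM
  rw [Nat.card_fin] at hk
  have hN : M.code.bound = TransFun.numBehaviours (Nat.card (Fin n)) m := by
    rw [Nat.card_fin]; rfl
  rw [hr.haltsOnEveryInput_iff hk hN]
  have hin (w : List (Fin m)) :
      (∀ a ∈ w.map Fin.val, M.code.input[a]? = some true) ↔ ∀ a ∈ w, a ∈ M.inputAlphabet := by
    simp
  have hhalt (t : ℕ) (w : List (Fin m)) :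
      (TransFun.ofTable M.code.table).haltsWithin t (List.replicate M.code.bound M.code.blank)
        M.code.start (w.map Fin.val ++ List.replicate M.code.bound M.code.blank) =
      M.transFun.haltsWithin t (List.replicate M.code.bound M.blank) M.start
        (w ++ List.replicate M.code.bound M.blank) := by
    rw [← TransFun.haltsWithin_map Fin.val Fin.val (ofTable_code M), List.map_append,
      List.map_replicate, blank_code, start_code]
  constructor
  · intro h w hl hw
    have := h w.length (List.mem_range.2 (by omega)) (w.map Fin.val)
      (mem_words.2 ⟨by simp, by simp⟩)
    rw [hin, hhalt] at this
    exact this.resolve_left (not_not.2 hw)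
  · intro h k hk' w hw
    obtain ⟨hl, hw'⟩ := mem_words.1 hw
    obtain ⟨w, rfl⟩ : ∃ v : List (Fin m), v.map Fin.val = w := by
      lift w to List (Fin m) using fun a ha => List.mem_range.1 (hw' a ha)
      exact ⟨w, rfl⟩
    subst hl
    rw [hin, hhalt, List.length_map]
    by_cases hA : ∀ a ∈ w, a ∈ M.inputAlphabet
    · exact Or.inr (h w (by simpa [Nat.lt_succ_iff] using hk') hA)
    · exact Or.inl hA

end Correctness

end DTM

theorem mainTheorem4 :
    ComputablePred fun c : DTM.Code =>
      ∃ (n m : ℕ) (M : DTM (Fin n) (Fin m)),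
        M.code = c ∧ M.IsWeightReducing ∧ M.HaltsOnEveryInput := by
  -- Validity comes first: it makes `c` the code of an actual machine, for which the other two tests
  -- have their intended meaning.
  refine ComputablePred.of_eq (PrimrecPred.computablePred
    (DTM.Code.primrecPred_isValid.and
      (DTM.Code.primrecPred_hasRank.and DTM.Code.primrecPred_haltsOnShortInputs))) fun c => ?_
  constructor
  · rintro ⟨hc, hr, hh⟩
    obtain ⟨n, m, M, rfl⟩ := hc.exists_code_eq
    have hM := (DTM.hasRank_code M).1 hr
    exact ⟨n, m, M, rfl, hM, (DTM.haltsOnShortInputs_code M hM).1 hh⟩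
  · rintro ⟨n, m, M, rfl, hM, hh⟩
    exact ⟨DTM.isValid_code M, (DTM.hasRank_code M).2 hM,
      (DTM.haltsOnShortInputs_code M hM).2 hh⟩
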